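/- Rings are additive abelian groups with a bi-additive multiplication and an identity element $1\neq 0$; multiplication is not assumed associative, and ideals are two-sided. For such a ring $T$, let $N(T)$ be its nucleus, i.e. the associative unital subring of all $r\in T$ such that $(rs)t=r(st)$, $(sr)t=s(rt)$ and $(st)r=s(tr)$ for all $s,t\in T$, and let $N(T)^\times$ be the group of units of $N(T)$ (equivalently, the elements of $N(T)$ that have a two-sided inverse in $T$). Let $Z(T)$ be the centre of $T$, i.e. the set of all $r\in N(T)$ with $rs=sr$ for all $s\in T$. A non-associative crossed system $(T,G,\sigma,\alpha)$ consists of such a ring $T$, a group $G$ with identity $e$, and maps $\sigma\colon G\to\mathrm{Aut}(T)$ and $\alpha\colon G\times G\to N(T)^\times$ such that for all $g,h,s\in G$ and $a\in T$: (N1) $\sigma_g(\sigma_h(a))=\alpha(g,h)\,\sigma_{gh}(a)\,\alpha(g,h)^{-1}$; (N2) $\alpha(g,h)\,\alpha(gh,s)=\sigma_g(\alpha(h,s))\,\alpha(g,hs)$; (N3) $\sigma_e=\mathrm{id}_T$ and $\alpha(g,e)=\alpha(e,g)=1$. The associated non-associative crossed product $T\rtimes_\sigma^\alpha G$ is the set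 of finite formal sums $\sum_{g\in G}t_gu_g$ $(t_g\in T)$ with coordinatewise addition and with the bi-additive multiplication determined by $(a u_g)(b u_h)=a\,\sigma_g(b)\,\alpha(g,h)\,u_{gh}$ for $a,b\in T$ and $g,h\in G$; $T$ is identified with $Tu_e$. The ring $T$ is called $G$-simple if $\{0\}$ and $T$ are the only ideals $I$ of $T$ with $\sigma_g(I)\subseteq I$ for all $g\in G$. Put $Z(T)^G=\{t\in Z(T)\mid \sigma_g(t)=t \text{ for all } g\in G\}$. A group is hypercentral if each of its non-trivial factor groups has a non-trivial centre; $Z(G)$ denotes the centre of $G$. **Theorem.** Let $T\rtimes_\sigma^\alpha G$ be a non-associative crossed product, where $G$ is a torsion-free hypercentral group. Then the following three conditions are equivalent: (i) $T\rtimes_\sigma^\alpha G$ is simple; (ii) $T$ is $G$-simple and $Z(T\rtimes_\sigma^\alpha G)=Z(T)^G$; (iii) $T$ is $G$-simple and there do not exist $u\in N(T)^\times$ and $g\in Z(G)\setminus\{e\}$ such that for every $h\in G$ and every $t\in T$ the relations $\sigma_h(u)=u\,\alpha(g,h)\,\alpha(h,g)^{-1}$ and $\sigma_g(t)=u^{-1}tu$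 hold. -/

import Mathlib

/-- The nucleus `N(T)` of a not necessarily associative unital ring `T`: the elements that
associate with all others in the left, middle and right position. -/
def nonassocNucleus (T : Type*) [NonAssocRing T] : Subring T where
  carrier := {r | (∀ s t : T, r * s * t = r * (s * t)) ∧
    (∀ s t : T, s * r * t = s * (r * t)) ∧ (∀ s t : T, s * t * r = s * (t * r))}
  mul_mem' := by
    rintro a b ⟨ha1, ha2, ha3⟩ ⟨hb1, hb2, hb3⟩
    refine ⟨fun s t => ?_, fun s t => ?_, fun s t => ?_⟩
    · rw [ha1, ha1, ha1, hb1]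
    · rw [← hb3, hb2, ha2, ha1]
    · rw [← hb3, ha3, hb3, hb3]
  one_mem' := by simp
  add_mem' := by
    rintro a b ⟨ha1, ha2, ha3⟩ ⟨hb1, hb2, hb3⟩
    refine ⟨fun s t => ?_, fun s t => ?_, fun s t => ?_⟩
    · simp only [add_mul, ha1, hb1]
    · simp only [add_mul, mul_add, ha2, hb2]
    · simp only [mul_add, ha3, hb3]
  zero_mem' := by simp
  neg_mem' := by
    rintro a ⟨ha1, ha2, ha3⟩
    refine ⟨fun s t => ?_, fun s t => ?_, fun s t => ?_⟩
    · simp only [neg_mul, ha1]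
    · simp only [neg_mul, mul_neg, ha2]
    · simp only [mul_neg, ha3]

/-- The nucleus is an associative unital ring (with the operations of `T`), so that its group of
units `(nonassocNucleus T)ˣ` makes sense. -/
instance nonassocNucleusRing (T : Type*) [NonAssocRing T] : Ring (nonassocNucleus T) :=
  { (inferInstance : NonAssocRing (nonassocNucleus T)) with
    mul_assoc := fun a b c => Subtype.ext (a.2.1 b c) }

/-- A non-associative crossed system `(T, G, σ, α)`: maps `σ : G → Aut(T)` and
`α : G × G → N(T)ˣ` subject to the three conditions (N1), (N2), (N3) below. -/
structure NonassocCrossedSystem (T G : Type*) [NonAssocRing T] [Group G] where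
  /-- the map `σ : G → Aut(T)` -/
  σ : G → (T ≃+* T)
  /-- the map `α : G × G → N(T)ˣ` -/
  α : G → G → (nonassocNucleus T)ˣ
  twisted_action : ∀ (g h : G) (a : T),
    σ g (σ h a) = ((α g h : nonassocNucleus T) : T) * σ (g * h) a *
      (((α g h)⁻¹ : (nonassocNucleus T)ˣ) : nonassocNucleus T)
  cocycle : ∀ g h s : G,
    ((α g h : nonassocNucleus T) : T) * ((α (g * h) s : nonassocNucleus T) : T) =
      σ g ((α h s : nonassocNucleus T) : T) * ((α g (h * s) : nonassocNucleus T) : T)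
  σ_one : σ 1 = RingEquiv.refl T
  α_one_right : ∀ g : G, α g 1 = 1
  α_one_left : ∀ g : G, α 1 g = 1

namespace NonassocCrossedSystem

variable {T G : Type*} [NonAssocRing T] [Group G]

/-- The biadditive extension of `(a u_g) (b u_h) = a σ_g(b) α(g,h) u_{gh}` to finite formal sums
`∑ t_g u_g`, encoded by the finitely supported functions `g ↦ t_g`. -/
noncomputable def mulFun (S : NonassocCrossedSystem T G) (x y : G →₀ T) : G →₀ T :=
  x.sum fun g a => y.sum fun h b =>
    Finsupp.single (g * h) (a * S.σ g b * ((S.α g h : nonassocNucleus T) : T))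

theorem mulFun_single_single (S : NonassocCrossedSystem T G) (g h : G) (a b : T) :
    S.mulFun (Finsupp.single g a) (Finsupp.single h b) =
      Finsupp.single (g * h) (a * S.σ g b * ((S.α g h : nonassocNucleus T) : T)) := by
  unfold mulFun
  rw [Finsupp.sum_single_index, Finsupp.sum_single_index]
  · simp
  · simp

theorem mulFun_add (S : NonassocCrossedSystem T G) (x y z : G →₀ T) :
    S.mulFun x (y + z) = S.mulFun x y + S.mulFun x z := by
  unfold mulFun
  rw [← Finsupp.sum_add]
  refine Finsupp.sum_congr fun g _ => ?_
  refine Finsupp.sum_add_index' (fun h => ?_) (fun h b c => ?_)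
  · simp
  · simp [mul_add, add_mul]

theorem add_mulFun (S : NonassocCrossedSystem T G) (x y z : G →₀ T) :
    S.mulFun (x + y) z = S.mulFun x z + S.mulFun y z := by
  unfold mulFun
  refine Finsupp.sum_add_index' (fun h => ?_) (fun h b c => ?_)
  · simp
  · simp [add_mul, Finsupp.sum_add]

theorem one_mulFun (S : NonassocCrossedSystem T G) (x : G →₀ T) :
    S.mulFun (Finsupp.single 1 1) x = x := by
  unfold mulFun
  rw [Finsupp.sum_single_index]
  · simp [S.σ_one, S.α_one_left]
  · simp

theorem mulFun_one (S : NonassocCrossedSystem T G) (x : G →₀ T) :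
    S.mulFun x (Finsupp.single 1 1) = x := by
  unfold mulFun
  have h : ∀ (g : G) (a : T), ((Finsupp.single (1 : G) (1 : T)).sum fun h b =>
      Finsupp.single (g * h) (a * S.σ g b * ((S.α g h : nonassocNucleus T) : T))) =
        Finsupp.single g a := by
    intro g a
    rw [Finsupp.sum_single_index]
    · simp [S.α_one_right]
    · simp
  simp only [h]
  exact Finsupp.sum_single x

/-- The crossed product `T ⋊_σ^α G`: the finite formal sums `∑ t_g u_g` with coordinatewise
addition and the multiplication `mulFun`. -/
def Product (_S : NonassocCrossedSystem T G) : Type _ := G →₀ T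

noncomputable instance (S : NonassocCrossedSystem T G) : AddCommGroup S.Product :=
  inferInstanceAs (AddCommGroup (G →₀ T))

noncomputable instance (S : NonassocCrossedSystem T G) : NonAssocRing S.Product :=
  { (inferInstance : AddCommGroup S.Product) with
    mul := S.mulFun
    one := Finsupp.single (1 : G) (1 : T)
    left_distrib := S.mulFun_add
    right_distrib := S.add_mulFun
    zero_mul := fun x => by
      change S.mulFun 0 x = 0
      simp [mulFun]
    mul_zero := fun x => by
      change S.mulFun x 0 = 0
      simp [mulFun, Finsupp.sum]
    one_mul := S.one_mulFun
    mul_one := S.mulFun_one }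

/-- The identification of `t ∈ T` with the element `t u_e` of the crossed product. -/
noncomputable def base (S : NonassocCrossedSystem T G) (t : T) : S.Product :=
  (Finsupp.single 1 t : G →₀ T)

/-- A (two-sided) ideal `I` of `T` is `G`-invariant if `σ_g(I) ⊆ I` for all `g`. -/
def IsInvariant (S : NonassocCrossedSystem T G) (I : TwoSidedIdeal T) : Prop :=
  ∀ g : G, ∀ t ∈ I, S.σ g t ∈ I

/-- `T` is `G`-simple if its only `G`-invariant ideals are `{0}` and `T`. -/
def IsGSimple (S : NonassocCrossedSystem T G) : Prop :=
  ∀ I : TwoSidedIdeal T, S.IsInvariant I → I = ⊥ ∨ I = ⊤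

/-- `Z(T)^G`, the set of central elements of `T` that are fixed by all `σ_g`; the centre
`Set.center T` consists of the elements that commute and associate with all others. -/
def fixedCenter (S : NonassocCrossedSystem T G) : Set T :=
  {t | t ∈ Set.center T ∧ ∀ g : G, S.σ g t = t}

end NonassocCrossedSystem

/-- A group is hypercentral if each of its non-trivial factor groups has a non-trivial centre. -/
def IsHypercentralGroup (G : Type*) [Group G] : Prop :=
  ∀ (N : Subgroup G) [N.Normal], Nontrivial (G ⧸ N) → Nontrivial (Subgroup.center (G ⧸ N))

/-- A group is torsion-free if only its identity element has finite order. -/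
def IsTorsionFreeGroup (G : Type*) [Group G] : Prop :=
  ∀ g : G, IsOfFinOrder g → g = 1

/-!
(i) ⇒ (iii): A `G`-invariant ideal of `T` extends to an ideal of the crossed product. A pair
`(u, g)` as in (iii) is the same thing as a central element `u u_g`. In a simple ring the central
element `1 + u u_g` would be invertible, but multiplying it by an inverse `w` and comparing
coefficients shows that the degrees of `w` among the powers of `g`, an element of infinite order,
would form a set that is both finite and, away from one point, invariant under a shift.

(iii) ⇒ (ii): The set of degrees of a central element `z` is finite and stable under conjugation.
In a torsion-free hypercentral group finite conjugacy classes are central, so every homogeneous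
component `a u_g` of `z` is itself central. Then `T a` is a `G`-invariant ideal, hence `a` is a
unit and (iii) forces `g = 1`.

(ii) ⇒ (i): By transfinite induction along the upper central series of `G`, the crossed product
`T ⋊ N` has no proper non-zero ideal that is stable under conjugation by all `u_h`. In the step
from `N` to `M` with `M / N` central, take a non-zero `x` in such an ideal `J` of `T ⋊ M` whose
degrees meet as few cosets of `N` as possible, one of them being `N` itself. On the elements of `J`
with degrees in these cosets the projection to `T ⋊ N` is injective. It commutes with all available
operations, so its image is an ideal of `T ⋊ N` and contains `1`. By injectivity the preimage of
`1` is central, so it lies in `T` and equals `1`.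
-/
section CentralSeries

variable {G : Type*} [Group G] (N : Subgroup G) [N.Normal]

theorem le_upperCentralSeriesStep : N ≤ N.upperCentralSeriesStep := fun x hx y => by
  rw [commutatorElement_def, mul_assoc, mul_assoc, ← mul_assoc y]
  exact N.mul_mem hx (Subgroup.Normal.conj_mem ‹_› _ (N.inv_mem hx) y)

theorem upperCentralSeriesStep_normal : N.upperCentralSeriesStep.Normal := by
  rw [Subgroup.upperCentralSeriesStep_eq_comap_center]
  infer_instance

end CentralSeries

namespace IsHypercentralGroup

open scoped commutatorElement

variable {G : Type*} [Group G]

theorem not_upperCentralSeriesStep_le (hG : IsHypercentralGroup G) {N : Subgroup G} [N.Normal]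
    (hN : N ≠ ⊤) : ¬ N.upperCentralSeriesStep ≤ N := by
  have := hG N (QuotientGroup.nontrivial_iff.2 hN)
  obtain ⟨⟨z, hz⟩, hz1⟩ := exists_ne (1 : Subgroup.center (G ⧸ N))
  obtain ⟨g, rfl⟩ := QuotientGroup.mk'_surjective N z
  rw [← Subgroup.mem_comap, ← Subgroup.upperCentralSeriesStep_eq_comap_center] at hz
  exact fun hle => hz1 (Subtype.ext ((QuotientGroup.eq_one_iff g).2 (hle hz)))

theorem upperCentralSeries_induction (hG : IsHypercentralGroup G) {P : Subgroup G → Prop}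
    (bot : P ⊥) (sSup : ∀ c : Set (Subgroup G), c.Nonempty → IsChain (· ≤ ·) c →
      (∀ N ∈ c, N.Normal ∧ P N) → P (sSup c))
    (step : ∀ (N : Subgroup G) [N.Normal], P N → P N.upperCentralSeriesStep) : P ⊤ := by
  obtain ⟨N, -, hN⟩ := zorn_le_nonempty₀ {N : Subgroup G | N.Normal ∧ P N}
    (fun c hc hchain N hN => ⟨_, ⟨Subgroup.sSup_normal c fun M hM => (hc hM).1,
      sSup c ⟨N, hN⟩ hchain fun M hM => hc hM⟩, fun M hM => le_sSup hM⟩)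
    ⊥ ⟨inferInstance, bot⟩
  obtain ⟨_, hPN⟩ := hN.prop
  obtain rfl | hN_ne_top := eq_or_ne N ⊤
  · exact hPN
  · exact absurd (hN.le_of_ge ⟨upperCentralSeriesStep_normal N, step N hPN⟩
      (le_upperCentralSeriesStep N)) (hG.not_upperCentralSeriesStep_le hN_ne_top)

theorem commute_of_commute_pow (hG : IsHypercentralGroup G) (hG' : IsTorsionFreeGroup G)
    {g x : G} {n : ℕ} (hn : n ≠ 0) (h : Commute (g ^ n) x) : Commute g x := by
  suffices ∀ x ∈ (⊤ : Subgroup G), ∀ g : G, Commute (g ^ n) x → Commute g x from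
    this x trivial g h
  refine hG.upperCentralSeries_induction
    (P := fun N => ∀ x ∈ N, ∀ g : G, Commute (g ^ n) x → Commute g x)
    ?bot ?sSup fun N _ hN x hx g hgx => ?step
  case bot => simp
  case sSup =>
    intro c hne hchain hc x hx
    obtain ⟨N, hNc, hxN⟩ := (Subgroup.mem_sSup_of_directedOn hne hchain.directedOn).1 hx
    exact (hc N hNc).2 x hxN
  case step =>
    have conj_eq : x * g * x⁻¹ = ⁅x, g⁆ * g := by simp [commutatorElement_def]
    have pow_comm_g : Commute (g ^ n) g := Commute.pow_self g n
    have comm : Commute ⁅x, g⁆ g := (hN _ (hx g) g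
      (((hgx.mul_right pow_comm_g).mul_right hgx.inv_right).mul_right pow_comm_g.inv_right)).symm
    have pow_eq_one : ⁅x, g⁆ ^ n = 1 := by
      rw [← mul_eq_right (b := g ^ n), ← comm.mul_pow, ← conj_eq, conj_pow, ← hgx.eq,
        mul_inv_cancel_right]
    have : ⁅x, g⁆ = 1 := hG' _ (isOfFinOrder_iff_pow_eq_one.2 ⟨n, hn.pos, pow_eq_one⟩)
    exact (commutatorElement_eq_one_iff_commute.1 this).symm

theorem mem_center_of_finite_conjugatesOf (hG : IsHypercentralGroup G)
    (hG' : IsTorsionFreeGroup G) {x : G} (hx : (conjugatesOf x).Finite) :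
    x ∈ Subgroup.center G := by
  refine Subgroup.mem_center_iff.2 fun g => ?_
  obtain ⟨i, j, hij, h⟩ := hx.exists_lt_map_eq_of_forall_mem (f := fun k : ℕ => g ^ k * x / g ^ k)
    fun k => isConj_iff.2 ⟨g ^ k, by rw [div_eq_mul_inv]⟩
  refine hG.commute_of_commute_pow hG' (Nat.sub_ne_zero_of_lt hij) ?_
  obtain ⟨d, rfl⟩ := Nat.exists_eq_add_of_le hij.le
  rw [pow_add, mul_assoc, mul_div_assoc, mul_div_assoc, mul_right_inj, div_mul_eq_div_div_swap,
    div_left_inj, eq_div_iff_mul_eq'] at h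
  rw [Nat.add_sub_cancel_left]
  exact h.symm

end IsHypercentralGroup

theorem eq_empty_of_finite_of_mem_iff_sub_one_mem {s : Set ℤ} (hs : s.Finite)
    (h : ∀ n ≠ 0, n ∈ s ↔ n - 1 ∈ s) : s = ∅ := by
  by_contra! hne
  obtain ⟨a, ha, le_a⟩ := s.exists_max_image id hs hne
  obtain ⟨b, hb, b_le⟩ := s.exists_min_image id hs hne
  have hb0 : b = 0 := by
    by_contra h0
    exact absurd (b_le _ ((h b h0).1 hb)) (by simp)
  have ha1 : a + 1 = 0 := by
    by_contra h0
    exact absurd (le_a (a + 1) ((h _ h0).2 (by simpa using ha))) (by simp)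
  have : b ≤ a := b_le a ha
  omega

namespace nonassocNucleus

variable {T : Type*} [NonAssocRing T] {a b c : T}

theorem left_assoc (ha : a ∈ nonassocNucleus T) (s t : T) : a * s * t = a * (s * t) := ha.1 s t

theorem mid_assoc (ha : a ∈ nonassocNucleus T) (s t : T) : s * a * t = s * (a * t) := ha.2.1 s t

theorem right_assoc (ha : a ∈ nonassocNucleus T) (s t : T) : s * t * a = s * (t * a) := ha.2.2 s t

theorem map_mem (f : T ≃+* T) (ha : a ∈ nonassocNucleus T) : f a ∈ nonassocNucleus T := by
  refine ⟨f.surjective.forall₂.2 fun s t => ?_, f.surjective.forall₂.2 fun s t => ?_,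
    f.surjective.forall₂.2 fun s t => ?_⟩ <;>
  simp only [← map_mul, left_assoc ha, mid_assoc ha, right_assoc ha]

theorem eq_of_mul_eq_one (ha : a ∈ nonassocNucleus T) (hba : b * a = 1) (hac : a * c = 1) :
    b = c := by
  rw [← mul_one b, ← hac, ← mid_assoc ha, hba, one_mul]

theorem mem_of_mul_eq_one (ha : a ∈ nonassocNucleus T) (hba : b * a = 1) (hab : a * b = 1) :
    b ∈ nonassocNucleus T := by
  have left_cancel {x y : T} (h : a * x = a * y) : x = y := by
    rw [← one_mul x, ← hba, mid_assoc ha, h, ← mid_assoc ha, hba, one_mul]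
  have right_cancel {x y : T} (h : x * a = y * a) : x = y := by
    rw [← mul_one x, ← hab, ← mid_assoc ha, h, mid_assoc ha, hab, mul_one]
  have mul_mul_cancel (x : T) : a * (b * x) = x := by rw [← left_assoc ha, hab, one_mul]
  have mul_mul_cancel' (x : T) : x * b * a = x := by rw [right_assoc ha, hba, mul_one]
  refine ⟨fun s t => left_cancel ?_, fun s t => ?_, fun s t => right_cancel ?_⟩
  · rw [← left_assoc ha, mul_mul_cancel, mul_mul_cancel]
  · rw [← mul_mul_cancel t, ← mid_assoc ha, mul_mul_cancel', mul_mul_cancel]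
  · rw [mul_mul_cancel', right_assoc ha, mul_mul_cancel']

theorem exists_units_eq (ha : a ∈ nonassocNucleus T) (hba : b * a = 1) (hac : a * c = 1) :
    ∃ u : (nonassocNucleus T)ˣ, (u.1 : T) = a := by
  obtain rfl := eq_of_mul_eq_one ha hba hac
  exact ⟨⟨⟨a, ha⟩, ⟨b, mem_of_mul_eq_one ha hba hac⟩, Subtype.ext hac, Subtype.ext hba⟩, rfl⟩

section Units

variable (u : (nonassocNucleus T)ˣ) {x y : T}

@[simp]
theorem val_mul_inv : (u.1 : T) * (u⁻¹).1 = 1 := congrArg Subtype.val u.mul_inv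

@[simp]
theorem inv_mul_val : ((u⁻¹).1 : T) * u.1 = 1 := congrArg Subtype.val u.inv_mul

@[simp]
theorem mul_val_mul_inv (x : T) : x * u.1 * (u⁻¹).1 = x := by
  rw [right_assoc (u⁻¹).1.2, val_mul_inv, mul_one]

@[simp]
theorem mul_inv_mul_val (x : T) : x * (u⁻¹).1 * u.1 = x := by
  rw [right_assoc u.1.2, inv_mul_val, mul_one]

@[simp]
theorem val_mul_inv_mul (x : T) : (u.1 : T) * ((u⁻¹).1 * x) = x := by
  rw [← left_assoc u.1.2, val_mul_inv, one_mul]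

@[simp]
theorem inv_mul_val_mul (x : T) : ((u⁻¹).1 : T) * (u.1 * x) = x := by
  rw [← left_assoc (u⁻¹).1.2, inv_mul_val, one_mul]

theorem mul_val_inj : x * u.1 = y * u.1 ↔ x = y :=
  ⟨fun h => by rw [← mul_val_mul_inv u x, h, mul_val_mul_inv], congrArg (· * _)⟩

theorem val_mul_inj : (u.1 : T) * x = u.1 * y ↔ x = y :=
  ⟨fun h => by rw [← inv_mul_val_mul u x, h, inv_mul_val_mul], congrArg (_ * ·)⟩

theorem mul_val_eq_zero : x * u.1 = 0 ↔ x = 0 := by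
  rw [← mul_val_inj u (x := x), zero_mul]

theorem val_mul_eq_zero : (u.1 : T) * x = 0 ↔ x = 0 := by
  rw [← val_mul_inj u (x := x), mul_zero]

end Units

theorem mem_center_iff {z : T} :
    z ∈ Set.center T ↔ z ∈ nonassocNucleus T ∧ ∀ t, Commute z t := by
  constructor
  · exact fun h => ⟨⟨fun s t => (h.left_assoc s t).symm, h.mid_assoc, h.right_assoc⟩, h.comm⟩
  · exact fun ⟨hz, hcomm⟩ => ⟨hcomm, fun s t => (left_assoc hz s t).symm, right_assoc hz⟩

section TwistedPrincipalIdeal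

variable (ha : a ∈ nonassocNucleus T) {f : T → T} (hf : f.Surjective)
  (haf : ∀ t, a * f t = t * a)

/-- The two-sided ideal `T a` generated by a nuclear element `a` that commutes with `T` up to a
surjective twist `f`. For `f = id` this is the principal ideal of a central element. -/
def twistedPrincipalIdeal : TwoSidedIdeal T :=
  .mk' (Set.range (· * a)) ⟨0, zero_mul a⟩
    (by rintro _ _ ⟨s, rfl⟩ ⟨t, rfl⟩; exact ⟨s + t, add_mul s t a⟩)
    (by rintro _ ⟨s, rfl⟩; exact ⟨-s, neg_mul s a⟩)
    (by rintro r _ ⟨s, rfl⟩; exact ⟨r * s, right_assoc ha r s⟩)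
    (by
      rintro _ r ⟨s, rfl⟩
      obtain ⟨t, rfl⟩ := hf r
      exact ⟨s * t, (right_assoc ha s t).trans (by rw [← haf, mid_assoc ha])⟩)

theorem mem_twistedPrincipalIdeal {x : T} :
    x ∈ twistedPrincipalIdeal ha hf haf ↔ ∃ t, t * a = x :=
  TwoSidedIdeal.mem_mk' ..

theorem self_mem_twistedPrincipalIdeal : a ∈ twistedPrincipalIdeal ha hf haf :=
  (mem_twistedPrincipalIdeal ha hf haf).2 ⟨1, one_mul a⟩

theorem exists_units_eq_of_one_mem (h : (1 : T) ∈ twistedPrincipalIdeal ha hf haf) :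
    ∃ u : (nonassocNucleus T)ˣ, (u.1 : T) = a := by
  obtain ⟨b, hb⟩ := (mem_twistedPrincipalIdeal ha hf haf).1 h
  exact exists_units_eq ha hb ((haf b).trans hb)

end TwistedPrincipalIdeal

theorem exists_units_eq_of_mem_center [IsSimpleRing T] {z : T} (hz : z ∈ Set.center T)
    (hz0 : z ≠ 0) : ∃ u : (nonassocNucleus T)ˣ, (u.1 : T) = z := by
  obtain ⟨hz_nucleus, hcomm⟩ := mem_center_iff.1 hz
  exact exists_units_eq_of_one_mem hz_nucleus Function.surjective_id hcomm
    (IsSimpleRing.one_mem_of_ne_zero_mem _ hz0 (self_mem_twistedPrincipalIdeal ..))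

end nonassocNucleus

namespace NonassocCrossedSystem

open nonassocNucleus

variable {T G : Type*} [NonAssocRing T] [Group G] {S : NonassocCrossedSystem T G}

section Basic

theorem σ_one_apply (S : NonassocCrossedSystem T G) (t : T) : S.σ 1 t = t := by
  rw [S.σ_one, RingEquiv.refl_apply]

theorem σ_σ_mul_α (S : NonassocCrossedSystem T G) (g h : G) (a : T) :
    S.σ g (S.σ h a) * (S.α g h).1 = (S.α g h).1 * S.σ (g * h) a := by
  rw [S.twisted_action, mul_inv_mul_val]

/-- The homogeneous element `a u_g` of the crossed product. -/
noncomputable def monomial (g : G) : T →+ S.Product := Finsupp.singleAddHom (M := T) g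

/-- The coefficient of `u_g` in an element of the crossed product. -/
def coeff (g : G) : S.Product →+ T := Finsupp.applyAddHom (M := T) g

/-- The finite set of degrees in which an element of the crossed product has a non-zero
coefficient. -/
def supp (x : S.Product) : Finset G := Finsupp.support (M := T) x

theorem mem_supp {x : S.Product} {g : G} : g ∈ supp x ↔ coeff g x ≠ 0 :=
  Finsupp.mem_support_iff (M := T)

theorem ext_coeff {x y : S.Product} (h : ∀ g, coeff g x = coeff g y) : x = y :=
  Finsupp.ext (M := T) h

theorem base_eq_monomial (t : T) : S.base t = monomial 1 t := rfl

theorem one_eq_monomial : (1 : S.Product) = monomial 1 1 := rfl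

@[simp]
theorem coeff_monomial_self (g : G) (a : T) : coeff g (monomial g a : S.Product) = a :=
  Finsupp.single_eq_same (M := T)

theorem coeff_monomial_of_ne {g k : G} (hkg : k ≠ g) (a : T) :
    coeff k (monomial g a : S.Product) = 0 :=
  Finsupp.single_eq_of_ne (M := T) hkg

theorem sum_monomial_coeff (x : S.Product) : ∑ g ∈ supp x, monomial g (coeff g x) = x :=
  Finsupp.sum_single (M := T) x

theorem monomial_induction {P : S.Product → Prop} (x : S.Product) (zero : P 0)
    (add : ∀ x y, P x → P y → P (x + y)) (monomial : ∀ g a, P (monomial g a)) : P x :=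
  Finsupp.induction_linear (M := T) (motive := P) x zero add monomial

theorem monomial_mul_monomial (g h : G) (a b : T) :
    (monomial g a * monomial h b : S.Product) = monomial (g * h) (a * S.σ g b * (S.α g h).1) :=
  S.mulFun_single_single g h a b

theorem coeff_monomial_mul (g k : G) (a : T) (x : S.Product) :
    coeff (g * k) (monomial g a * x) = a * S.σ g (coeff k x) * (S.α g k).1 := by
  induction x using monomial_induction with
  | zero => simp only [mul_zero, map_zero, zero_mul]
  | add x y hx hy => simp only [mul_add, map_add, hx, hy, add_mul]
  | monomial h b =>
    rw [monomial_mul_monomial]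
    obtain rfl | hkh := eq_or_ne k h
    · simp only [coeff_monomial_self]
    · rw [coeff_monomial_of_ne (by simpa using hkh), coeff_monomial_of_ne hkh, map_zero, mul_zero,
        zero_mul]

theorem coeff_mul_monomial (k h : G) (b : T) (x : S.Product) :
    coeff (k * h) (x * monomial h b) = coeff k x * S.σ k b * (S.α k h).1 := by
  induction x using monomial_induction with
  | zero => simp only [map_zero, zero_mul]
  | add x y hx hy => simp only [map_add, hx, hy, add_mul]
  | monomial g a =>
    rw [monomial_mul_monomial]
    obtain rfl | hkg := eq_or_ne k g
    · simp only [coeff_monomial_self]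
    · rw [coeff_monomial_of_ne (by simpa using hkg), coeff_monomial_of_ne hkg, zero_mul, zero_mul]

theorem coeff_base_mul (k : G) (t : T) (x : S.Product) :
    coeff k (S.base t * x) = t * coeff k x := by
  simpa [base_eq_monomial, S.σ_one_apply, S.α_one_left] using coeff_monomial_mul 1 k t x

theorem coeff_mul_base (k : G) (t : T) (x : S.Product) :
    coeff k (x * S.base t) = coeff k x * S.σ k t := by
  simpa [base_eq_monomial, S.α_one_right] using coeff_mul_monomial k 1 t x

theorem base_mul_monomial (t : T) (g : G) (a : T) :
    S.base t * monomial g a = monomial g (t * a) := by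
  rw [base_eq_monomial, monomial_mul_monomial, one_mul, S.σ_one_apply, S.α_one_left]
  exact congrArg _ (mul_one _)

theorem monomial_mul_base (g : G) (a t : T) :
    monomial g a * S.base t = monomial g (a * S.σ g t) := by
  rw [base_eq_monomial, monomial_mul_monomial, mul_one, S.α_one_right]
  exact congrArg _ (mul_one _)

theorem base_mul_base (s t : T) : S.base s * S.base t = S.base (s * t) :=
  base_mul_monomial s 1 t

end Basic

section Nucleus

theorem monomial_mul_monomial_mul_monomial (g h k : G) (a b c : T) :
    (monomial g a * monomial h b * monomial k c : S.Product) = monomial (g * h * k)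
      (a * S.σ g b * S.σ g (S.σ h c) * ((S.α g h).1 * (S.α (g * h) k).1)) := by
  rw [monomial_mul_monomial, monomial_mul_monomial, mid_assoc (S.α g h).1.2, ← σ_σ_mul_α,
    ← right_assoc (S.α g h).1.2, right_assoc (S.α (g * h) k).1.2]

theorem monomial_mul_monomial_mul_monomial' (g h k : G) (a b c : T) :
    (monomial g a * (monomial h b * monomial k c) : S.Product) = monomial (g * h * k)
      (a * (S.σ g b * S.σ g (S.σ h c)) * ((S.α g h).1 * (S.α (g * h) k).1)) := by
  rw [monomial_mul_monomial, monomial_mul_monomial, map_mul (S.σ g), map_mul (S.σ g),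
    S.cocycle, mul_assoc g h k, ← right_assoc (map_mem (S.σ g) (S.α h k).1.2),
    right_assoc (S.α g (h * k)).1.2]

theorem mul_assoc_of_coeff {x y z : S.Product}
    (hxyz : ∀ g h k, coeff g x * S.σ g (coeff h y) * S.σ g (S.σ h (coeff k z)) =
      coeff g x * (S.σ g (coeff h y) * S.σ g (S.σ h (coeff k z)))) :
    x * y * z = x * (y * z) := by
  rw [← sum_monomial_coeff x, ← sum_monomial_coeff y, ← sum_monomial_coeff z]
  simp only [Finset.sum_mul, Finset.mul_sum, monomial_mul_monomial_mul_monomial,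
    monomial_mul_monomial_mul_monomial', hxyz]

theorem coeff_mem_nonassocNucleus {z : S.Product}
    (left : ∀ s t, z * S.base s * S.base t = z * (S.base s * S.base t))
    (mid : ∀ s t, S.base s * z * S.base t = S.base s * (z * S.base t))
    (right : ∀ s t, S.base s * S.base t * z = S.base s * (S.base t * z)) (g : G) :
    coeff g z ∈ nonassocNucleus T := by
  refine ⟨(S.σ g).surjective.forall₂.2 fun s t => ?_, fun s t => ?_, fun s t => ?_⟩
  · simpa only [base_mul_base, coeff_mul_base, map_mul] using congrArg (coeff g) (left s t)
  · obtain ⟨t, rfl⟩ := (S.σ g).surjective t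
    simpa only [coeff_mul_base, coeff_base_mul] using congrArg (coeff g) (mid s t)
  · simpa only [base_mul_base, coeff_base_mul] using congrArg (coeff g) (right s t)

theorem mem_nonassocNucleus_iff {z : S.Product} :
    z ∈ nonassocNucleus S.Product ↔ ∀ g, coeff g z ∈ nonassocNucleus T := by
  refine ⟨fun hz => coeff_mem_nonassocNucleus (fun _ _ => left_assoc hz _ _)
    (fun _ _ => mid_assoc hz _ _) fun _ _ => right_assoc hz _ _,
    fun hz => ⟨fun x y => ?_, fun x y => ?_, fun x y => ?_⟩⟩
  · exact mul_assoc_of_coeff fun g h k => left_assoc (hz g) _ _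
  · exact mul_assoc_of_coeff fun g h k => mid_assoc (map_mem _ (hz h)) _ _
  · exact mul_assoc_of_coeff fun g h k => right_assoc (map_mem _ (map_mem _ (hz k))) _ _

theorem monomial_mem_nonassocNucleus_iff {g : G} {a : T} :
    (monomial g a : S.Product) ∈ nonassocNucleus S.Product ↔ a ∈ nonassocNucleus T := by
  refine mem_nonassocNucleus_iff.trans ⟨fun h => ?_, fun ha k => ?_⟩
  · simpa only [coeff_monomial_self] using h g
  · obtain rfl | hkg := eq_or_ne k g
    · rwa [coeff_monomial_self]
    · rw [coeff_monomial_of_ne hkg]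
      exact zero_mem _

end Nucleus

section Conj

theorem α_inv_right (S : NonassocCrossedSystem T G) (h : G) :
    ((S.α h h⁻¹).1 : T) = S.σ h (S.α h⁻¹ h).1 := by
  simpa [S.α_one_left, S.α_one_right] using S.cocycle h h⁻¹ h

/-- The element `u_h` of the crossed product, as a unit of the nucleus. -/
noncomputable def basisUnit (S : NonassocCrossedSystem T G) (h : G) :
    (nonassocNucleus S.Product)ˣ where
  val := ⟨monomial h 1, monomial_mem_nonassocNucleus_iff.2 (one_mem _)⟩
  inv := ⟨monomial h⁻¹ ((S.α h⁻¹ h)⁻¹).1, monomial_mem_nonassocNucleus_iff.2 (Subtype.prop _)⟩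
  val_inv := Subtype.ext <| by
    change monomial h 1 * monomial h⁻¹ _ = _
    rw [monomial_mul_monomial, α_inv_right, one_mul, ← map_mul, inv_mul_val, map_one,
      mul_inv_cancel]
    rfl
  inv_val := Subtype.ext <| by
    change monomial h⁻¹ _ * monomial h 1 = _
    rw [monomial_mul_monomial, map_one, mul_one, inv_mul_val, inv_mul_cancel]
    rfl

theorem basisUnit_val (h : G) : ((S.basisUnit h).1 : S.Product) = monomial h 1 := rfl

theorem coeff_basisUnit_mul (h k : G) (x : S.Product) :
    coeff (h * k) ((S.basisUnit h).1 * x : S.Product) = S.σ h (coeff k x) * (S.α h k).1 := by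
  rw [basisUnit_val, coeff_monomial_mul, one_mul]

theorem coeff_mul_basisUnit (k h : G) (x : S.Product) :
    coeff (k * h) (x * (S.basisUnit h).1 : S.Product) = coeff k x * (S.α k h).1 := by
  rw [basisUnit_val, coeff_mul_monomial, map_one, mul_one]

theorem base_mul_basisUnit (t : T) (h : G) :
    (S.base t * (S.basisUnit h).1 : S.Product) = monomial h t := by
  rw [basisUnit_val, base_mul_monomial, mul_one]

theorem commute_of_commute_base_basisUnit {z : S.Product} (hz : z ∈ nonassocNucleus S.Product)
    (hbase : ∀ t, Commute z (S.base t)) (hbasis : ∀ h, Commute z (S.basisUnit h).1)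
    (x : S.Product) : Commute z x := by
  induction x using monomial_induction with
  | zero => exact Commute.zero_right z
  | add x y hx hy => exact hx.add_right hy
  | monomial h t =>
    rw [← base_mul_basisUnit, commute_iff_eq, ← left_assoc hz, (hbase t).eq, mid_assoc hz,
      (hbasis h).eq, right_assoc hz]

/-- Conjugation by `u_h` in the crossed product. -/
noncomputable def conj (h : G) : S.Product →+ S.Product :=
  (AddMonoidHom.mulRight (((S.basisUnit h)⁻¹).1 : S.Product)).comp
    (AddMonoidHom.mulLeft ((S.basisUnit h).1 : S.Product))

theorem conj_apply (h : G) (x : S.Product) :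
    conj h x = (S.basisUnit h).1 * x * ((S.basisUnit h)⁻¹).1 := rfl

theorem conj_mul_basisUnit (h : G) (x : S.Product) :
    conj h x * (S.basisUnit h).1 = (S.basisUnit h).1 * x := by
  rw [conj_apply, mul_inv_mul_val]

theorem conj_eq_self_iff {h : G} {x : S.Product} :
    conj h x = x ↔ Commute x (S.basisUnit h).1 := by
  rw [← mul_val_inj (S.basisUnit h), conj_mul_basisUnit, commute_iff_eq, eq_comm]

theorem coeff_conj (h k : G) (x : S.Product) :
    coeff (h * k * h⁻¹) (conj h x) * (S.α (h * k * h⁻¹) h).1 =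
      S.σ h (coeff k x) * (S.α h k).1 := by
  rw [← coeff_mul_basisUnit, conj_mul_basisUnit, inv_mul_cancel_right, coeff_basisUnit_mul]

theorem coeff_conj_eq_zero_iff {h k : G} {x : S.Product} :
    coeff (h * k * h⁻¹) (conj h x) = 0 ↔ coeff k x = 0 := by
  rw [← mul_val_eq_zero (S.α (h * k * h⁻¹) h), coeff_conj, mul_val_eq_zero, map_eq_zero_iff]
  exact (S.σ h).injective

theorem conj_base (h : G) (t : T) : conj h (S.base t) = S.base (S.σ h t) := by
  rw [← mul_val_inj (S.basisUnit h), conj_mul_basisUnit, base_mul_basisUnit, basisUnit_val,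
    monomial_mul_base, one_mul]

end Conj

section Center

theorem mem_center_iff_conj {z : S.Product} :
    z ∈ Set.center S.Product ↔ z ∈ nonassocNucleus S.Product ∧
      (∀ t, Commute z (S.base t)) ∧ ∀ h, conj h z = z := by
  rw [mem_center_iff]
  refine and_congr_right fun hz => ⟨fun h => ⟨fun t => h _, fun g => conj_eq_self_iff.2 (h _)⟩,
    fun ⟨hbase, hconj⟩ => ?_⟩
  exact commute_of_commute_base_basisUnit hz hbase fun h => conj_eq_self_iff.1 (hconj h)

theorem commute_base_iff {z : S.Product} {t : T} :
    Commute z (S.base t) ↔ ∀ g, coeff g z * S.σ g t = t * coeff g z := by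
  simp only [← coeff_mul_base, ← coeff_base_mul]
  exact ⟨fun h g => congrArg _ h.eq, ext_coeff⟩

theorem conj_eq_self_iff_coeff {h : G} {z : S.Product} :
    conj h z = z ↔ ∀ g, coeff (h * g * h⁻¹) z * (S.α (h * g * h⁻¹) h).1 =
      S.σ h (coeff g z) * (S.α h g).1 := by
  simp only [← coeff_conj, mul_val_inj]
  refine ⟨fun hz g => by rw [hz], fun hz => ext_coeff fun g => ?_⟩
  obtain ⟨k, rfl⟩ := (MulAut.conj h).surjective g
  exact (hz k).symm

theorem mem_center_iff_coeff {z : S.Product} :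
    z ∈ Set.center S.Product ↔ ∀ g, coeff g z ∈ nonassocNucleus T ∧
      (∀ t, coeff g z * S.σ g t = t * coeff g z) ∧
      ∀ h, coeff (h * g * h⁻¹) z * (S.α (h * g * h⁻¹) h).1 =
        S.σ h (coeff g z) * (S.α h g).1 := by
  simp only [mem_center_iff_conj, mem_nonassocNucleus_iff, commute_base_iff,
    conj_eq_self_iff_coeff, forall_and, forall_comm (α := G) (β := T)]
  rw [forall_comm (α := G) (β := G)]

theorem monomial_mem_center_iff {g : G} (hg : g ∈ Subgroup.center G) {a : T} :
    (monomial g a : S.Product) ∈ Set.center S.Product ↔ a ∈ nonassocNucleus T ∧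
      (∀ t, a * S.σ g t = t * a) ∧
      ∀ h, a * (S.α g h).1 = S.σ h a * (S.α h g).1 := by
  have conj_g (h : G) : h * g * h⁻¹ = g := by
    rw [Subgroup.mem_center_iff.1 hg h, mul_inv_cancel_right]
  refine mem_center_iff_coeff.trans ⟨fun h => ?_, fun ha k => ?_⟩
  · simpa only [coeff_monomial_self, conj_g] using h g
  · obtain rfl | hkg := eq_or_ne k g
    · simpa only [coeff_monomial_self, conj_g] using ha
    · have conj_k (h : G) : h * k * h⁻¹ ≠ g := fun H =>
        hkg (conj_injective (H.trans (conj_g h).symm))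
      simp only [coeff_monomial_of_ne hkg, coeff_monomial_of_ne (conj_k _), map_zero, zero_mul,
        mul_zero, implies_true, and_self, and_true]
      exact zero_mem _

theorem monomial_coeff_mem_center {z : S.Product} (hz : z ∈ Set.center S.Product) {g : G}
    (hg : g ∈ Subgroup.center G) : (monomial g (coeff g z) : S.Product) ∈ Set.center S.Product := by
  obtain ⟨ha, hbase, hconj⟩ := mem_center_iff_coeff.1 hz g
  refine (monomial_mem_center_iff hg).2 ⟨ha, hbase, fun h => ?_⟩
  simpa only [Subgroup.mem_center_iff.1 hg h, mul_inv_cancel_right] using hconj h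

theorem monomial_unit_mem_center_iff {g : G} (hg : g ∈ Subgroup.center G)
    (u : (nonassocNucleus T)ˣ) :
    (monomial g u.1 : S.Product) ∈ Set.center S.Product ↔ ∀ h t,
      S.σ h u.1 = (u * S.α g h * (S.α h g)⁻¹).1 ∧ S.σ g t = ((u⁻¹).1 : T) * t * u.1 := by
  have twist_iff (t : T) : (u.1 : T) * S.σ g t = t * u.1 ↔ S.σ g t = ((u⁻¹).1 : T) * t * u.1 := by
    rw [right_assoc u.1.2, ← val_mul_inj u (y := (u⁻¹).1 * _), val_mul_inv_mul]
  have basis_iff (h : G) : (u.1 : T) * (S.α g h).1 = S.σ h u.1 * (S.α h g).1 ↔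
      S.σ h u.1 = (u * S.α g h * (S.α h g)⁻¹).1 := by
    rw [← mul_val_inj (S.α h g) (x := S.σ h _), eq_comm, Units.val_mul, Units.val_mul,
      Subring.coe_mul, Subring.coe_mul, mul_inv_mul_val]
  simp only [monomial_mem_center_iff hg, SetLike.coe_mem, true_and, twist_iff, basis_iff,
    forall_and, forall_const, and_comm]

theorem base_mem_center_iff {t : T} : S.base t ∈ Set.center S.Product ↔ t ∈ S.fixedCenter := by
  have fixed_iff (h : G) : t = S.σ h t ↔ S.σ h t = t := eq_comm
  rw [base_eq_monomial, monomial_mem_center_iff (one_mem _)]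
  simp only [S.α_one_left, S.α_one_right, S.σ_one_apply, Units.val_one, OneMemClass.coe_one,
    mul_one, fixedCenter, mem_center_iff, Set.mem_ofPred_eq, and_assoc, commute_iff_eq, fixed_iff]

theorem center_eq_base_image_fixedCenter_iff :
    Set.center S.Product = S.base '' S.fixedCenter ↔
      Set.center S.Product ⊆ Set.range S.base := by
  have : S.base '' S.fixedCenter = Set.center S.Product ∩ Set.range S.base := by
    rw [← Set.image_preimage_eq_inter_range]
    congr 1
    ext t
    exact base_mem_center_iff.symm
  rw [this, eq_comm, Set.inter_eq_left]

theorem supp_subset_center (hG : IsHypercentralGroup G) (hG' : IsTorsionFreeGroup G)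
    {z : S.Product} (hz : ∀ h, conj h z = z) : (supp z : Set G) ⊆ Subgroup.center G := by
  refine fun g hg => hG.mem_center_of_finite_conjugatesOf hG' ((supp z).finite_toSet.subset ?_)
  intro k hk
  obtain ⟨h, rfl⟩ := isConj_iff.1 hk
  rw [Finset.mem_coe, mem_supp] at hg ⊢
  rwa [← hz h, Ne, coeff_conj_eq_zero_iff]

end Center

section GSimple

theorem IsGSimple.exists_units_eq (hS : S.IsGSimple) {g : G} (hg : g ∈ Subgroup.center G) {a : T}
    (ha0 : a ≠ 0) (hz : (monomial g a : S.Product) ∈ Set.center S.Product) :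
    ∃ u : (nonassocNucleus T)ˣ, (u.1 : T) = a := by
  obtain ⟨ha, hbase, hconj⟩ := (monomial_mem_center_iff hg).1 hz
  set I := twistedPrincipalIdeal ha (S.σ g).surjective hbase
  have ha_mem : a ∈ I := self_mem_twistedPrincipalIdeal ..
  have hI : S.IsInvariant I := by
    intro h x hx
    obtain ⟨t, rfl⟩ := (mem_twistedPrincipalIdeal ..).1 hx
    have σ_a : S.σ h a = a * (S.α g h).1 * ((S.α h g)⁻¹).1 := by rw [hconj, mul_val_mul_inv]
    rw [map_mul, σ_a]
    exact I.mul_mem_left _ _ (I.mul_mem_right _ _ (I.mul_mem_right _ _ ha_mem))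
  have hI_ne_bot : I ≠ ⊥ := fun h => ha0 (by rwa [h, TwoSidedIdeal.mem_bot] at ha_mem)
  have hI_top : I = ⊤ := (hS I hI).resolve_left hI_ne_bot
  exact exists_units_eq_of_one_mem ha _ hbase (hI_top ▸ TwoSidedIdeal.mem_top T)

theorem center_subset_range_base (hG : IsHypercentralGroup G) (hG' : IsTorsionFreeGroup G)
    (hS : S.IsGSimple)
    (hu : ∀ u : (nonassocNucleus T)ˣ, ∀ g ∈ Subgroup.center G, g ≠ 1 →
      (monomial g u.1 : S.Product) ∉ Set.center S.Product) :
    Set.center S.Product ⊆ Set.range S.base := by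
  intro z hz
  have coeff_eq_zero (g : G) (hg1 : g ≠ 1) : coeff g z = 0 := by
    by_contra hg
    have hgc := supp_subset_center hG hG' (mem_center_iff_conj.1 hz).2.2 (mem_supp.2 hg)
    have hmem := monomial_coeff_mem_center hz hgc
    obtain ⟨u, hua⟩ := hS.exists_units_eq hgc hg hmem
    exact hu u g hgc hg1 (hua ▸ hmem)
  refine ⟨coeff 1 z, ext_coeff fun g => ?_⟩
  rw [base_eq_monomial]
  obtain rfl | hg1 := eq_or_ne g 1
  · rw [coeff_monomial_self]
  · rw [coeff_eq_zero g hg1, coeff_monomial_of_ne hg1]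

theorem coeff_mul_mem_left {I : TwoSidedIdeal T} (hI : S.IsInvariant I) (x : S.Product)
    {y : S.Product} (hy : ∀ g, coeff g y ∈ I) (g : G) : coeff g (x * y) ∈ I := by
  rw [← sum_monomial_coeff x, Finset.sum_mul, map_sum]
  refine sum_mem fun h _ => ?_
  rw [← mul_inv_cancel_left h g, coeff_monomial_mul]
  exact I.mul_mem_right _ _ (I.mul_mem_left _ _ (hI _ _ (hy _)))

theorem coeff_mul_mem_right {I : TwoSidedIdeal T} {x : S.Product} (hx : ∀ g, coeff g x ∈ I)
    (y : S.Product) (g : G) : coeff g (x * y) ∈ I := by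
  rw [← sum_monomial_coeff y, Finset.mul_sum, map_sum]
  refine sum_mem fun h _ => ?_
  rw [← inv_mul_cancel_right g h, coeff_mul_monomial]
  exact I.mul_mem_right _ _ (I.mul_mem_right _ _ (hx _))

/-- The ideal of the crossed product generated by a `G`-invariant ideal `I` of `T`, encoded as
the set of the elements all of whose coefficients lie in `I`. -/
noncomputable def extendIdeal {I : TwoSidedIdeal T} (hI : S.IsInvariant I) :
    TwoSidedIdeal S.Product :=
  .mk' {x | ∀ g, coeff g x ∈ I} (fun g => by rw [map_zero]; exact I.zero_mem)
    (fun hx hy g => by rw [map_add]; exact I.add_mem (hx g) (hy g))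
    (fun hx g => by rw [map_neg]; exact I.neg_mem (hx g))
    (fun hy => coeff_mul_mem_left hI _ hy) (fun hx => coeff_mul_mem_right hx _)

theorem base_mem_extendIdeal_iff {I : TwoSidedIdeal T} (hI : S.IsInvariant I) {t : T} :
    S.base t ∈ extendIdeal hI ↔ t ∈ I := by
  refine (TwoSidedIdeal.mem_mk' ..).trans ⟨fun h => ?_, fun ht g => ?_⟩
  · simpa only [base_eq_monomial, coeff_monomial_self] using h 1
  · obtain rfl | hg1 := eq_or_ne g 1
    · rwa [base_eq_monomial, coeff_monomial_self]
    · rw [base_eq_monomial, coeff_monomial_of_ne hg1]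
      exact I.zero_mem

theorem base_eq_zero_iff {t : T} : S.base t = 0 ↔ t = 0 := by
  refine ⟨fun h => ?_, fun h => by rw [h, base_eq_monomial, map_zero]⟩
  rw [← coeff_monomial_self (S := S) 1 t, ← base_eq_monomial, h, map_zero]

theorem isGSimple_of_isSimpleRing [IsSimpleRing S.Product] : S.IsGSimple := by
  refine fun I hI => (eq_bot_or_eq_top (extendIdeal hI)).imp (fun h => ?_) (fun h => ?_) <;>
    ext t
  · rw [← base_mem_extendIdeal_iff hI, h, TwoSidedIdeal.mem_bot, TwoSidedIdeal.mem_bot,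
      base_eq_zero_iff]
  · simp only [← base_mem_extendIdeal_iff hI, h, TwoSidedIdeal.mem_top]

end GSimple

section CentralUnits

theorem one_add_monomial_mul_ne_one [Nontrivial T] {g : G} (hg : ¬ IsOfFinOrder g)
    (u : (nonassocNucleus T)ˣ) (w : S.Product) : (1 + (monomial g u.1 : S.Product)) * w ≠ 1 := by
  intro hw
  have coeff_eq (n : ℤ) : coeff (g ^ n) w + u.1 * S.σ g (coeff (g ^ (n - 1)) w) *
      (S.α g (g ^ (n - 1))).1 = coeff (g ^ n) (1 : S.Product) := by
    have hn : g ^ n = g * g ^ (n - 1) := by rw [← zpow_one_add, add_sub_cancel]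
    rw [← hw, add_mul, one_mul, map_add, hn, coeff_monomial_mul]
  have zpow_inj : Function.Injective fun n : ℤ => g ^ n :=
    injective_zpow_iff_not_isOfFinOrder.2 hg
  have support_finite : {n : ℤ | coeff (g ^ n) w ≠ 0}.Finite :=
    ((supp w).finite_toSet.preimage zpow_inj.injOn).subset fun n hn => mem_supp.2 hn
  have support_empty : {n : ℤ | coeff (g ^ n) w ≠ 0} = ∅ := by
    refine eq_empty_of_finite_of_mem_iff_sub_one_mem support_finite fun n hn => not_congr ?_
    have hgn : g ^ n ≠ 1 := by simpa using zpow_inj.ne hn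
    have h := coeff_eq n
    rw [one_eq_monomial, coeff_monomial_of_ne hgn] at h
    have twist_eq_zero_iff : (u.1 : T) * S.σ g (coeff (g ^ (n - 1)) w) *
        (S.α g (g ^ (n - 1))).1 = 0 ↔ coeff (g ^ (n - 1)) w = 0 := by
      rw [mul_val_eq_zero, val_mul_eq_zero, map_eq_zero_iff _ (S.σ g).injective]
    rw [← twist_eq_zero_iff]
    exact ⟨fun h0 => by rwa [h0, zero_add] at h, fun h0 => by rwa [h0, add_zero] at h⟩
  have coeff_eq_zero (n : ℤ) : coeff (g ^ n) w = 0 := by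
    simpa using Set.eq_empty_iff_forall_notMem.1 support_empty n
  have h := coeff_eq 0
  rw [coeff_eq_zero, coeff_eq_zero, map_zero, mul_zero, zero_mul, add_zero, zpow_zero,
    one_eq_monomial, coeff_monomial_self] at h
  exact zero_ne_one h

theorem monomial_unit_notMem_center [Nontrivial T] [IsSimpleRing S.Product] {g : G}
    (hg : ¬ IsOfFinOrder g) (u : (nonassocNucleus T)ˣ) :
    (monomial g u.1 : S.Product) ∉ Set.center S.Product := by
  intro hz
  have hg1 : 1 ≠ g := fun h => hg (h ▸ IsOfFinOrder.one)
  have hne : 1 + (monomial g u.1 : S.Product) ≠ 0 := fun h => by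
    have := congrArg (coeff 1) h
    rw [map_add, one_eq_monomial, coeff_monomial_self, coeff_monomial_of_ne hg1, add_zero,
      map_zero] at this
    exact one_ne_zero this
  obtain ⟨v, hv⟩ := exists_units_eq_of_mem_center (Set.add_mem_center Set.one_mem_center hz) hne
  refine one_add_monomial_mul_ne_one hg u ((v⁻¹).1 : S.Product) ?_
  rw [← hv, val_mul_inv]

end CentralUnits

section Support

/-- The elements of the crossed product all of whose degrees lie in `A`. For a subgroup `N` of
`G`, `S.supportedOn N` is the crossed product `T ⋊ N`. -/
def supportedOn (S : NonassocCrossedSystem T G) (A : Set G) : AddSubgroup S.Product where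
  carrier := {x | ∀ g ∉ A, coeff g x = 0}
  add_mem' hx hy g hg := by rw [map_add, hx g hg, hy g hg, add_zero]
  zero_mem' g _ := map_zero _
  neg_mem' hx g hg := by rw [map_neg, hx g hg, neg_zero]

theorem mem_supportedOn_iff {A : Set G} {x : S.Product} :
    x ∈ S.supportedOn A ↔ (supp x : Set G) ⊆ A :=
  forall_congr' fun _ => not_imp_comm.trans (imp_congr_left mem_supp.symm)

open Classical in
/-- The projection of the crossed product onto `T ⋊ N` that drops all degrees outside `N`. -/
noncomputable def restr (N : Subgroup G) : S.Product →+ S.Product :=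
  Finsupp.filterAddHom (M := T) (· ∈ N)

variable {N : Subgroup G}

theorem coeff_restr_of_mem {g : G} (hg : g ∈ N) (x : S.Product) :
    coeff g (restr N x) = coeff g x := by
  classical exact Finsupp.filter_apply_pos (M := T) (· ∈ N) x hg

theorem coeff_restr_of_notMem {g : G} (hg : g ∉ N) (x : S.Product) :
    coeff g (restr N x) = 0 := by
  classical exact Finsupp.filter_apply_neg (M := T) (· ∈ N) x hg

theorem restr_mem_supportedOn (N : Subgroup G) (x : S.Product) : restr N x ∈ S.supportedOn N :=
  fun _ hg => coeff_restr_of_notMem hg x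

theorem restr_base_mul (N : Subgroup G) (t : T) (x : S.Product) :
    restr N (S.base t * x) = S.base t * restr N x := by
  refine ext_coeff fun g => ?_
  by_cases hg : g ∈ N
  · simp only [coeff_restr_of_mem hg, coeff_base_mul]
  · simp only [coeff_restr_of_notMem hg, coeff_base_mul, mul_zero]

theorem restr_mul_base (N : Subgroup G) (t : T) (x : S.Product) :
    restr N (x * S.base t) = restr N x * S.base t := by
  refine ext_coeff fun g => ?_
  by_cases hg : g ∈ N
  · simp only [coeff_restr_of_mem hg, coeff_mul_base]
  · simp only [coeff_restr_of_notMem hg, coeff_mul_base, zero_mul]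

theorem restr_base (N : Subgroup G) (t : T) : restr N (S.base t) = S.base t := by
  refine ext_coeff fun g => ?_
  by_cases hg : g ∈ N
  · rw [coeff_restr_of_mem hg]
  · rw [coeff_restr_of_notMem hg, base_eq_monomial, coeff_monomial_of_ne]
    exact fun h => hg (h ▸ N.one_mem)

theorem restr_mul_basisUnit {n : G} (hn : n ∈ N) (x : S.Product) :
    restr N (x * (S.basisUnit n).1 : S.Product) = restr N x * (S.basisUnit n).1 := by
  refine ext_coeff fun g => ?_
  obtain ⟨k, rfl⟩ := (Group.mulRight_bijective n).surjective g
  have hkn : k * n ∈ N ↔ k ∈ N := N.mul_mem_cancel_right hn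
  by_cases hk : k ∈ N
  · simp only [coeff_restr_of_mem (hkn.2 hk), coeff_mul_basisUnit, coeff_restr_of_mem hk]
  · simp only [coeff_restr_of_notMem (mt hkn.1 hk), coeff_mul_basisUnit,
      coeff_restr_of_notMem hk, zero_mul]

theorem restr_conj [hN : N.Normal] (h : G) (x : S.Product) :
    restr N (conj h x) = conj h (restr N x) := by
  refine ext_coeff fun g => ?_
  obtain ⟨k, rfl⟩ := (MulAut.conj h).surjective g
  have hk_iff : h * k * h⁻¹ ∈ N ↔ k ∈ N := hN.mem_comm_iff.trans (by rw [inv_mul_cancel_left])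
  rw [MulAut.conj_apply]
  by_cases hk : k ∈ N
  · rw [← mul_val_inj (S.α (h * k * h⁻¹) h), coeff_restr_of_mem (hk_iff.2 hk), coeff_conj,
      coeff_conj, coeff_restr_of_mem hk]
  · rw [coeff_restr_of_notMem (mt hk_iff.1 hk), eq_comm, coeff_conj_eq_zero_iff,
      coeff_restr_of_notMem hk]

end Support

section InvariantSubbimodule

/-- `J` is stable under left and right multiplication by `T ⋊ N` and under conjugation by all
`u_h`, `h ∈ G`. Left multiplication by `u_n` need not be mentioned, since
`u_n x = (u_n x u_n⁻¹) u_n`. -/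
structure IsInvariantSubbimodule (N : Subgroup G) (J : AddSubgroup S.Product) : Prop where
  base_mul : ∀ t, ∀ x ∈ J, S.base t * x ∈ J
  mul_base : ∀ t, ∀ x ∈ J, x * S.base t ∈ J
  mul_basisUnit : ∀ n ∈ N, ∀ x ∈ J, x * (S.basisUnit n).1 ∈ J
  conj : ∀ h, ∀ x ∈ J, conj h x ∈ J

variable {N M : Subgroup G} {J : AddSubgroup S.Product}

namespace IsInvariantSubbimodule

theorem mono (hNM : N ≤ M) (hJ : IsInvariantSubbimodule M J) : IsInvariantSubbimodule N J where
  __ := hJ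
  mul_basisUnit n hn := hJ.mul_basisUnit n (hNM hn)

theorem inf_supportedOn (hJ : IsInvariantSubbimodule N J) {A : Set G}
    (mul_mem : ∀ g ∈ A, ∀ n ∈ N, g * n ∈ A) (conj_mem : ∀ g ∈ A, ∀ h, h * g * h⁻¹ ∈ A) :
    IsInvariantSubbimodule N (J ⊓ S.supportedOn A) where
  base_mul t x hx := ⟨hJ.base_mul t x hx.1, fun g hg => by
    rw [coeff_base_mul, hx.2 g hg, mul_zero]⟩
  mul_base t x hx := ⟨hJ.mul_base t x hx.1, fun g hg => by
    rw [coeff_mul_base, hx.2 g hg, zero_mul]⟩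
  mul_basisUnit n hn x hx := ⟨hJ.mul_basisUnit n hn x hx.1, fun g hg => by
    obtain ⟨k, rfl⟩ := (Group.mulRight_bijective n).surjective g
    rw [coeff_mul_basisUnit, hx.2 k fun hk => hg (mul_mem k hk n hn), zero_mul]⟩
  conj h x hx := ⟨hJ.conj h x hx.1, fun g hg => by
    obtain ⟨k, rfl⟩ := (MulAut.conj h).surjective g
    exact coeff_conj_eq_zero_iff.2 (hx.2 k fun hk => hg (conj_mem k hk h))⟩

theorem map_restr [N.Normal] (hJ : IsInvariantSubbimodule N J) :
    IsInvariantSubbimodule N (J.map (restr N)) where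
  base_mul := by
    rintro t _ ⟨x, hx, rfl⟩
    exact ⟨_, hJ.base_mul t x hx, restr_base_mul N t x⟩
  mul_base := by
    rintro t _ ⟨x, hx, rfl⟩
    exact ⟨_, hJ.mul_base t x hx, restr_mul_base N t x⟩
  mul_basisUnit := by
    rintro n hn _ ⟨x, hx, rfl⟩
    exact ⟨_, hJ.mul_basisUnit n hn x hx, restr_mul_basisUnit hn x⟩
  conj := by
    rintro h _ ⟨x, hx, rfl⟩
    exact ⟨_, hJ.conj h x hx, restr_conj h x⟩

theorem mem_center_of_restr_eq_one [N.Normal] (hJ : IsInvariantSubbimodule N J)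
    (hinj : ∀ x ∈ J, restr N x = 0 → x = 0) {y : S.Product} (hy : y ∈ J) (hy1 : restr N y = 1) :
    y ∈ Set.center S.Product := by
  have eq_of_restr_eq {x x' : S.Product} (hx : x ∈ J) (hx' : x' ∈ J)
      (h : restr N x = restr N x') : x = x' :=
    sub_eq_zero.1 (hinj _ (J.sub_mem hx hx') (by rw [map_sub, h, sub_self]))
  have y_mul (t : T) := hJ.mul_base t y hy
  have mul_y (t : T) := hJ.base_mul t y hy
  refine mem_center_iff_conj.2 ⟨mem_nonassocNucleus_iff.2 (coeff_mem_nonassocNucleus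
    (fun s t => ?_) (fun s t => ?_) fun s t => ?_), fun t => ?_, fun h => ?_⟩
  · rw [base_mul_base]
    refine eq_of_restr_eq (hJ.mul_base _ _ (y_mul s)) (y_mul _) ?_
    simp only [restr_mul_base, hy1, one_mul, base_mul_base]
  · refine eq_of_restr_eq (hJ.mul_base _ _ (mul_y s)) (hJ.base_mul _ _ (y_mul t)) ?_
    simp only [restr_mul_base, restr_base_mul, hy1, one_mul, mul_one]
  · rw [base_mul_base]
    refine eq_of_restr_eq (mul_y _) (hJ.base_mul _ _ (mul_y t)) ?_
    simp only [restr_base_mul, hy1, mul_one, base_mul_base]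
  · refine eq_of_restr_eq (y_mul t) (mul_y t) ?_
    rw [restr_mul_base, restr_base_mul, hy1, one_mul, mul_one]
  · refine eq_of_restr_eq (hJ.conj h y hy) hy ?_
    rw [restr_conj, hy1, conj_eq_self_iff]
    exact Commute.one_left _

end IsInvariantSubbimodule

end InvariantSubbimodule

section Cosets

/-- The cosets of `N` that contain a degree of `x`. Their number plays the role of the length of
`x` in the minimality argument for ideals of `T ⋊ M`, `N ≤ M`. -/
def cosets (N : Subgroup G) (x : S.Product) : Set (G ⧸ N) := (↑) '' (supp x : Set G)

variable {N M : Subgroup G} {J : AddSubgroup S.Product}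

theorem finite_cosets (N : Subgroup G) (x : S.Product) : (cosets N x).Finite :=
  (supp x).finite_toSet.image _

theorem cosets_subset_iff {x : S.Product} {Q : Set (G ⧸ N)} :
    cosets N x ⊆ Q ↔ x ∈ S.supportedOn ((↑) ⁻¹' Q) :=
  Set.image_subset_iff.trans mem_supportedOn_iff.symm

theorem mk_mem_cosets {x : S.Product} {g : G} (hg : coeff g x ≠ 0) : (g : G ⧸ N) ∈ cosets N x :=
  Set.mem_image_of_mem _ (mem_supp.2 hg)

variable [N.Normal]

theorem one_notMem_cosets {x : S.Product} (hx : restr N x = 0) : (1 : G ⧸ N) ∉ cosets N x := by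
  rintro ⟨g, hg, hg1⟩
  rw [Finset.mem_coe, mem_supp, ← coeff_restr_of_mem ((QuotientGroup.eq_one_iff g).1 hg1), hx,
    map_zero] at hg
  exact hg rfl

theorem cosets_subset_center {x : S.Product} (hx : x ∈ S.supportedOn N.upperCentralSeriesStep) :
    cosets N x ⊆ Subgroup.center (G ⧸ N) := by
  rwa [Subgroup.upperCentralSeriesStep_eq_comap_center, Subgroup.coe_comap,
    QuotientGroup.coe_mk', ← cosets_subset_iff] at hx

theorem ncard_cosets_mul_basisUnit_le (x : S.Product) (h : G) :
    (cosets N (x * (S.basisUnit h).1 : S.Product)).ncard ≤ (cosets N x).ncard := by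
  have hsub : cosets N (x * (S.basisUnit h).1 : S.Product) ⊆ (· * (h : G ⧸ N)) '' cosets N x := by
    rintro _ ⟨g, hg, rfl⟩
    obtain ⟨k, rfl⟩ := (Group.mulRight_bijective h).surjective g
    rw [Finset.mem_coe, mem_supp, coeff_mul_basisUnit, Ne, mul_val_eq_zero] at hg
    exact ⟨k, mk_mem_cosets hg, rfl⟩
  exact (Set.ncard_le_ncard hsub ((finite_cosets N x).image _)).trans
    (Set.ncard_image_le (finite_cosets N x))

theorem IsInvariantSubbimodule.exists_coeff_one_ne_zero_ncard_cosets_le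
    (hJ : IsInvariantSubbimodule M J) (hJM : J ≤ S.supportedOn M) (hJ0 : J ≠ ⊥) :
    ∃ x ∈ J, coeff 1 x ≠ 0 ∧ ∀ y ∈ J, y ≠ 0 → (cosets N x).ncard ≤ (cosets N y).ncard := by
  obtain ⟨z, ⟨hz, hz0⟩, hmin⟩ := exists_minimalFor_of_wellFoundedLT
    (fun z => z ∈ J ∧ z ≠ 0) (fun z => (cosets N z).ncard)
    (J.bot_or_exists_ne_zero.resolve_left hJ0)
  obtain ⟨m, hm⟩ : ∃ m, coeff m z ≠ 0 := by
    by_contra! h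
    exact hz0 (ext_coeff fun g => by rw [h, map_zero])
  have hmM : m ∈ M := not_imp_comm.1 (hJM hz m) hm
  have hle := ncard_cosets_mul_basisUnit_le (N := N) z m⁻¹
  refine ⟨_, hJ.mul_basisUnit m⁻¹ (M.inv_mem hmM) z hz, ?_, fun y hy hy0 =>
    hle.trans (le_of_not_gt fun hlt => hlt.not_ge (hmin ⟨hy, hy0⟩ hlt.le))⟩
  rwa [← mul_inv_cancel m, coeff_mul_basisUnit, Ne, mul_val_eq_zero]

theorem IsInvariantSubbimodule.exists_le_restr_injective
    (hJ : IsInvariantSubbimodule N.upperCentralSeriesStep J)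
    (hJN : J ≤ S.supportedOn N.upperCentralSeriesStep) (hJ0 : J ≠ ⊥) :
    ∃ K ≤ J, IsInvariantSubbimodule N K ∧ (∀ x ∈ K, restr N x = 0 → x = 0) ∧
      K.map (restr N) ≠ ⊥ := by
  obtain ⟨x, hx, hx1, hmin⟩ := hJ.exists_coeff_one_ne_zero_ncard_cosets_le (N := N) hJN hJ0
  have cosets_central := cosets_subset_center (hJN hx)
  refine ⟨J ⊓ S.supportedOn ((↑) ⁻¹' cosets N x), inf_le_left,
    (hJ.mono (le_upperCentralSeriesStep N)).inf_supportedOn ?mul_mem ?conj_mem,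
    fun z ⟨hz, hzx⟩ hz_restr => ?injective, fun h => ?ne_bot⟩
  case mul_mem =>
    intro g hg n hn
    rwa [Set.mem_preimage, QuotientGroup.mk_mul_of_mem g hn]
  case conj_mem =>
    intro g hg h
    rwa [Set.mem_preimage, QuotientGroup.mk_mul, QuotientGroup.mk_mul,
      Subgroup.mem_center_iff.1 (cosets_central hg) h, ← QuotientGroup.mk_mul,
      ← QuotientGroup.mk_mul, mul_inv_cancel_right]
  case injective =>
    by_contra hz0
    refine (hmin z hz hz0).not_gt (Set.ncard_lt_ncard ?_ (finite_cosets N x))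
    exact ⟨cosets_subset_iff.2 hzx, fun hle => one_notMem_cosets hz_restr (hle (mk_mem_cosets hx1))⟩
  case ne_bot =>
    have restr_x : restr N x ∈ (J ⊓ S.supportedOn ((↑) ⁻¹' cosets N x)).map (restr N) :=
      ⟨x, ⟨hx, cosets_subset_iff.1 Set.Subset.rfl⟩, rfl⟩
    rw [h, AddSubgroup.mem_bot] at restr_x
    rw [← coeff_restr_of_mem N.one_mem, restr_x, map_zero] at hx1
    exact hx1 rfl

end Cosets

section Simple

/-- `T ⋊ N` has no proper non-zero ideal that is stable under conjugation by all `u_h`,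
`h ∈ G`. The instances `N = ⊥` and `N = ⊤` amount to the `G`-simplicity of `T` and to the
simplicity of `T ⋊ G`. -/
def IsGSimpleOn (S : NonassocCrossedSystem T G) (N : Subgroup G) : Prop :=
  ∀ J ≤ S.supportedOn N, IsInvariantSubbimodule N J → J ≠ ⊥ → 1 ∈ J

theorem IsGSimple.isGSimpleOn_bot (hS : S.IsGSimple) : S.IsGSimpleOn ⊥ := by
  intro J hJ_supp hJ hJ0
  let I : TwoSidedIdeal T := .mk' (J.comap (monomial 1)) (zero_mem _) add_mem neg_mem
    (fun {s t} ht => by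
      rw [SetLike.mem_coe, AddSubgroup.mem_comap, ← base_eq_monomial, ← base_mul_base]
      exact hJ.base_mul s _ ht)
    (fun {s t} hs => by
      rw [SetLike.mem_coe, AddSubgroup.mem_comap, ← base_eq_monomial, ← base_mul_base]
      exact hJ.mul_base t _ hs)
  have mem_I {t : T} : t ∈ I ↔ S.base t ∈ J := TwoSidedIdeal.mem_mk' ..
  have hI : S.IsInvariant I := fun h t ht => by
    rw [mem_I] at ht ⊢
    exact conj_base h t ▸ hJ.conj h _ ht
  have eq_base (x : S.Product) (hx : x ∈ J) : x = S.base (coeff 1 x) := ext_coeff fun g => by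
    rw [base_eq_monomial]
    obtain rfl | hg := eq_or_ne g 1
    · rw [coeff_monomial_self]
    · rw [hJ_supp hx g hg, coeff_monomial_of_ne hg]
  have hI0 : I ≠ ⊥ := fun h => hJ0 <| (AddSubgroup.eq_bot_iff_forall J).2 fun x hx => by
    have : coeff 1 x ∈ I := mem_I.2 (eq_base x hx ▸ hx)
    rw [h, TwoSidedIdeal.mem_bot] at this
    rw [eq_base x hx, this, base_eq_zero_iff]
  have one_mem_I : (1 : T) ∈ I := (hS I hI).resolve_left hI0 ▸ TwoSidedIdeal.mem_top T
  exact mem_I.1 one_mem_I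

theorem isGSimpleOn_sSup {c : Set (Subgroup G)} (hne : c.Nonempty) (hchain : IsChain (· ≤ ·) c)
    (hc : ∀ N ∈ c, N.Normal ∧ S.IsGSimpleOn N) : S.IsGSimpleOn (sSup c) := by
  intro J hJ_supp hJ hJ0
  obtain ⟨x, hx, hx0⟩ := J.bot_or_exists_ne_zero.resolve_left hJ0
  obtain ⟨N, hNc, hxN⟩ := DirectedOn.exists_mem_subset_of_finset_subset_biUnion
    (f := ((↑) : Subgroup G → Set G)) hne hchain.directedOn (s := supp x) <| by
      intro g hg
      simpa only [Set.mem_iUnion₂, SetLike.mem_coe, exists_prop] using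
        (Subgroup.mem_sSup_of_directedOn hne hchain.directedOn).1
          (mem_supportedOn_iff.1 (hJ_supp hx) hg)
  obtain ⟨hN_normal, hN⟩ := hc N hNc
  have hJN : IsInvariantSubbimodule N (J ⊓ S.supportedOn N) :=
    (hJ.mono (le_sSup hNc)).inf_supportedOn (fun _ hg _ hn => N.mul_mem hg hn)
      hN_normal.conj_mem
  have hJN0 : J ⊓ S.supportedOn N ≠ ⊥ := fun h =>
    hx0 ((AddSubgroup.eq_bot_iff_forall _).1 h x ⟨hx, mem_supportedOn_iff.2 hxN⟩)
  exact (hN _ inf_le_right hJN hJN0).1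

theorem IsGSimpleOn.upperCentralSeriesStep (hc : Set.center S.Product ⊆ Set.range S.base)
    {N : Subgroup G} [N.Normal] (hN : S.IsGSimpleOn N) :
    S.IsGSimpleOn N.upperCentralSeriesStep := by
  intro J hJ_supp hJ hJ0
  obtain ⟨K, hKJ, hK, hK_inj, hK0⟩ := hJ.exists_le_restr_injective hJ_supp hJ0
  have map_le : K.map (restr N) ≤ S.supportedOn N := by
    rintro _ ⟨x, -, rfl⟩
    exact restr_mem_supportedOn N x
  obtain ⟨y, hy, hy1⟩ := hN _ map_le hK.map_restr hK0
  obtain ⟨t, rfl⟩ := hc (hK.mem_center_of_restr_eq_one hK_inj hy hy1)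
  rw [restr_base] at hy1
  exact hy1 ▸ hKJ hy

theorem isSimpleRing_of_isGSimpleOn_top [Nontrivial T] (hS : S.IsGSimpleOn ⊤) :
    IsSimpleRing S.Product := by
  have : Nontrivial S.Product := ⟨1, 0, fun h => one_ne_zero (α := T) (base_eq_zero_iff.1 h)⟩
  refine IsSimpleRing.of_eq_bot_or_eq_top fun I => or_iff_not_imp_left.2 fun hI0 => ?_
  refine I.one_mem_iff.1 (hS (AddSubgroup.ofClass I) (fun x _ _ hg => absurd trivial hg)
    ⟨fun t x hx => I.mul_mem_left _ _ hx, fun t x hx => I.mul_mem_right _ _ hx,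
      fun n _ x hx => I.mul_mem_right _ _ hx,
      fun h x hx => I.mul_mem_right _ _ (I.mul_mem_left _ _ hx)⟩ fun h => hI0 ?_)
  exact le_bot_iff.1 fun x hx => (AddSubgroup.eq_bot_iff_forall _).1 h x hx

theorem isSimpleRing_of_center_subset [Nontrivial T] (hG : IsHypercentralGroup G)
    (hS : S.IsGSimple) (hc : Set.center S.Product ⊆ Set.range S.base) :
    IsSimpleRing S.Product :=
  isSimpleRing_of_isGSimpleOn_top <| hG.upperCentralSeries_induction hS.isGSimpleOn_bot
    (fun _ => isGSimpleOn_sSup) fun _ _ => IsGSimpleOn.upperCentralSeriesStep hc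

end Simple

end NonassocCrossedSystem

theorem mainTheorem3 {T G : Type*} [NonAssocRing T] [Nontrivial T] [Group G]
    (hG : IsHypercentralGroup G) (hG' : IsTorsionFreeGroup G)
    (S : NonassocCrossedSystem T G) :
    List.TFAE [
      IsSimpleRing S.Product,
      S.IsGSimple ∧ Set.center S.Product = S.base '' S.fixedCenter,
      S.IsGSimple ∧
        ¬ ∃ (u : (nonassocNucleus T)ˣ) (g : G), g ∈ Subgroup.center G ∧ g ≠ 1 ∧
          ∀ (h : G) (t : T),
            S.σ h ((u : nonassocNucleus T) : T) =
              ((u * S.α g h * (S.α h g)⁻¹ : (nonassocNucleus T)ˣ) : nonassocNucleus T) ∧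
            S.σ g t = (((u⁻¹ : (nonassocNucleus T)ˣ) : nonassocNucleus T) : T) * t *
              ((u : nonassocNucleus T) : T)] := by
  tfae_have 1 → 3 := fun _ => by
    refine ⟨NonassocCrossedSystem.isGSimple_of_isSimpleRing, fun ⟨u, g, hg, hg1, hu⟩ => ?_⟩
    exact NonassocCrossedSystem.monomial_unit_notMem_center (mt (hG' g) hg1) u
      ((NonassocCrossedSystem.monomial_unit_mem_center_iff hg u).2 hu)
  tfae_have 3 → 2 := fun ⟨hS, hu⟩ => by
    refine ⟨hS, NonassocCrossedSystem.center_eq_base_image_fixedCenter_iff.2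
      (NonassocCrossedSystem.center_subset_range_base hG hG' hS fun u g hg hg1 hz => ?_)⟩
    exact hu ⟨u, g, hg, hg1, (NonassocCrossedSystem.monomial_unit_mem_center_iff hg u).1 hz⟩
  tfae_have 2 → 1 := fun ⟨hS, hc⟩ => NonassocCrossedSystem.isSimpleRing_of_center_subset hG hS
    (NonassocCrossedSystem.center_eq_base_image_fixedCenter_iff.1 hc)
  tfae_finish
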